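/- For a Borel probability measure $\nu$ on $\mathbb{R}$ with a density with respect to Lebesgue measure, say that $\nu$ satisfies a logarithmic Sobolev inequality with constant $c\in\mathbb{R}$ if $$\int f^2\log\frac{f^2}{\int f^2\,d\nu}\,d\nu\;\le\; c\int |f'|^2\,d\nu$$ for all locally absolutely continuous $f:\mathbb{R}\to[0,\infty)$ with $f,f'\in L^2(\nu)$ (in particular the integrand on the left is required to be $\nu$-integrable for all such $f$). The optimal log-Sobolev constant of $\nu$ is the least such $c$. Let $R>0$, let $\mu=\tfrac12(\delta_{-R}+\delta_R)$ be the symmetric two-point measure on $\mathbb{R}$ (where $\delta_{\pm R}$ denotes the unit point mass at $\pm R$), and for $\delta>0$ let $\gamma_\delta$ be the centered Gaussian measure on $\mathbb{R}$ of variance $\delta$. Then for every $0<\delta\le R^2$ the convolution $\mu*\gamma_\delta$ has an optimal log-Sobolev constant $c(\delta)$, and $$\frac{1}{11}\cdot\frac{\delta^{3/2}}{R}\exp\left(\frac{R^2}{2\delta}\right)\;\le\; c(\delta)\;\le\; 117942\cdot\frac{\delta^{3/2}}{R}\exp\left(\frac{R^2}{2\delta}\right).$$ Thus $c(\delta)$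 is determined up to absolute constant factors, i.e. both bounds are sharp up to absolute constants. -/

import Mathlib

open MeasureTheory ProbabilityTheory

noncomputable section

/-- The entropy functional `Ent_μ(g) = ∫ g log (g / ∫ g dμ) dμ`. -/
def entropy (μ : Measure ℝ) (g : ℝ → ℝ) : ℝ :=
  ∫ x, g x * Real.log (g x / ∫ y, g y ∂μ) ∂μ

/-- The energy `𝓔(f, f) = ∫ |f'|² dμ`. -/
def energy (μ : Measure ℝ) (f : ℝ → ℝ) : ℝ :=
  ∫ x, (deriv f x) ^ 2 ∂μ

/-- The test functions: nonnegative, locally absolutely continuous functions `f` on the line with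
`f` and `f'` in `L²(μ)`, i.e. the nonnegative elements of the weighted Sobolev space `H¹(μ)`.
A locally absolutely continuous function is differentiable Lebesgue-almost everywhere, so for `μ`
with a density (such as the convolution of any probability measure with a Gaussian) `deriv f` is
the derivative of `f` at `μ`-almost every point. -/
structure IsTestFunction (μ : Measure ℝ) (f : ℝ → ℝ) : Prop where
  nonneg : ∀ x, 0 ≤ f x
  absolutelyContinuous : ∀ a b : ℝ, AbsolutelyContinuousOnInterval f a b
  memLp : MemLp f 2 μ
  memLp_deriv : MemLp (deriv f) 2 μ

/-- `μ` satisfies the logarithmic Sobolev inequality `Ent_μ(f²) ≤ c 𝓔(f, f)` with constant `c`.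
For `f ∈ L²(μ)` the entropy of `f²` is always well defined in `[0, ∞]`; the inequality includes the
claim that it is finite, i.e. that its integrand is integrable. -/
def SatisfiesLSI (μ : Measure ℝ) (c : ℝ) : Prop :=
  ∀ f : ℝ → ℝ, IsTestFunction μ f →
    Integrable (fun x => f x ^ 2 * Real.log (f x ^ 2 / ∫ y, f y ^ 2 ∂μ)) μ ∧
      entropy μ (fun x => f x ^ 2) ≤ c * energy μ f

/-- The optimal log-Sobolev constant of `μ`: the smallest admissible constant. -/
def logSobolevConstant (μ : Measure ℝ) : ℝ :=
  sInf {c : ℝ | SatisfiesLSI μ c}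

/-- The symmetric two-point probability measure `½ (δ_{-R} + δ_R)`. -/
def twoPointMeasure (R : ℝ) : Measure ℝ :=
  (2⁻¹ : ENNReal) • (Measure.dirac (-R) + Measure.dirac R)

/-- The convolution `μ_δ = μ * γ_δ` of `μ` with the centered Gaussian of variance `δ`. -/
def gaussianSmoothing (μ : Measure ℝ) (δ : ℝ) : Measure ℝ :=
  Measure.conv μ (gaussianReal 0 δ.toNNReal)

end

open Set Filter Topology


/-! Scaling by `√δ` reduces the claim to the mixture of unit Gaussians at `±a`, `a = R / √δ ≥ 1`:
constants scale by `δ`, and the asserted rate is `δ K` with `K = exp (a² / 2) / a`, the cost of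
crossing the low-density region around `0`.

Upper bound. For every `τ > 0`, the entropy of `f²` is at most `∫ (f² log (f² / τ²) - f² + τ²)`.
Take `τ = f 0 + Q` with `Q²` just above `K E`, `E` the energy. Cauchy–Schwarz from `0` bounds `(f x
- f 0)²` by a multiple of `K E` up to the centre `a`, and of `K E exp ((x - a)²)` beyond. The
logarithm turns this last factor into the weight `(x - a)²` (`entropyIntegrand_le`), and a Gaussian
Hardy inequality started at `a` (`integral_sq_mul_gaussWeight_le`) absorbs that weight. Reflection
treats the other half-line.

Lower bound. A ramp from `0` to `1` on `[0, 1 / a]` has energy at most `1 / K`, while its entropy is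
bounded below because it lives on a half-line of mass `1 / 2`. -/

/-! ### Absolutely continuous functions -/

/-- Substitution in the integral of `deriv f` exhibits the composite as a primitive. Serves both the
reflection `s = -1` and the rescaling by `√δ`. -/
theorem absolutelyContinuousOnInterval_comp_mul {f : ℝ → ℝ}
    (hf : ∀ a b : ℝ, AbsolutelyContinuousOnInterval f a b) (s a b : ℝ) :
    AbsolutelyContinuousOnInterval (fun x => f (s * x)) a b := by
  have hi : IntervalIntegrable (fun t => s * deriv f (s * t)) volume a b := by
    rcases eq_or_ne s 0 with rfl | hs
    · simp
    · have := ((hf (s * a) (s * b)).intervalIntegrable_deriv.comp_mul_left (c := s)).const_mul s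
      simpa [hs] using this
  have h1 := hi.absolutelyContinuousOnInterval_intervalIntegral (c := a) (by simp)
  have hc : AbsolutelyContinuousOnInterval (fun _ : ℝ => f (s * a)) a b :=
    (LipschitzWith.const (f (s * a))).lipschitzOnWith.absolutelyContinuousOnInterval
  have h2 := hc.fun_add h1
  suffices h : (fun x => f (s * x)) =
      fun x => f (s * a) + ∫ (v : ℝ) in a..x, s * deriv f (s * v) by rwa [h]
  funext x
  have := intervalIntegral.mul_integral_comp_mul_left (a := a) (b := x) (f := deriv f) s
  rw [intervalIntegral.integral_const_mul, this, (hf _ _).integral_deriv_eq_sub]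
  ring

theorem continuous_of_absolutelyContinuousOnInterval {f : ℝ → ℝ}
    (hf : ∀ a b : ℝ, AbsolutelyContinuousOnInterval f a b) : Continuous f := by
  rw [continuous_iff_continuousAt]
  intro x
  refine (hf (x - 1) (x + 1)).continuousOn.continuousAt ?_
  rw [uIcc_of_le (by linarith)]
  exact Icc_mem_nhds (by linarith) (by linarith)

/-- Weighted Cauchy–Schwarz bound for the increments of an absolutely continuous function. -/
theorem sq_sub_le_integral_mul_integral {f w : ℝ → ℝ} {a b : ℝ} (hab : a ≤ b)
    (hf : AbsolutelyContinuousOnInterval f a b) (hw : Continuous w) (hpos : ∀ x, 0 < w x)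
    (hi : IntervalIntegrable (fun x => deriv f x ^ 2 * w x) volume a b) :
    (f b - f a) ^ 2 ≤
      (∫ x in a..b, deriv f x ^ 2 * w x) * ∫ x in a..b, (w x)⁻¹ := by
  set A := ∫ x in a..b, deriv f x ^ 2 * w x
  set B := ∫ x in a..b, (w x)⁻¹
  have hwi : IntervalIntegrable (fun x => (w x)⁻¹) volume a b :=
    (hw.inv₀ fun x => (hpos x).ne').intervalIntegrable _ _
  -- The integral of `(f' w - t)² / w` is a nonnegative quadratic in `t`; its discriminant gives the
  -- claim.
  have hq : ∀ t : ℝ, 0 ≤ B * (t * t) + (-(2 * (f b - f a))) * t + A := by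
    intro t
    have h1 : ∫ x in a..b, (deriv f x ^ 2 * w x + (t * t) * (w x)⁻¹ + (-(2 * t)) * deriv f x) =
        A + t * t * B + (-(2 * t)) * (f b - f a) := by
      rw [intervalIntegral.integral_add (hi.add (hwi.const_mul _))
        (hf.intervalIntegrable_deriv.const_mul _), intervalIntegral.integral_add hi
        (hwi.const_mul _), intervalIntegral.integral_const_mul,
        intervalIntegral.integral_const_mul, hf.integral_deriv_eq_sub]
    have h2 : 0 ≤ ∫ x in a..b,
        (deriv f x ^ 2 * w x + (t * t) * (w x)⁻¹ + (-(2 * t)) * deriv f x) := by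
      refine intervalIntegral.integral_nonneg hab fun x _ => ?_
      have : deriv f x ^ 2 * w x + (t * t) * (w x)⁻¹ + (-(2 * t)) * deriv f x =
          (deriv f x * w x - t) ^ 2 * (w x)⁻¹ := by
        have := (hpos x).ne'
        field_simp
        ring
      rw [this]
      exact mul_nonneg (sq_nonneg _) (inv_nonneg.2 (hpos x).le)
    linarith
  have := discrim_le_zero hq
  unfold discrim at this
  nlinarith

/-! ### Hardy inequality for the Gaussian weight -/

/-- The unnormalised Gaussian weight centred at `a`. -/
noncomputable def gaussWeight (a x : ℝ) : ℝ := Real.exp (-(x - a) ^ 2 / 2)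

theorem gaussWeight_pos (a x : ℝ) : 0 < gaussWeight a x := Real.exp_pos _

theorem continuous_gaussWeight (a : ℝ) : Continuous (gaussWeight a) := by
  unfold gaussWeight; fun_prop

theorem contDiff_gaussWeight (a : ℝ) : ContDiff ℝ 1 (gaussWeight a) := by
  unfold gaussWeight; fun_prop

theorem hasDerivAt_hardyWeight (a x : ℝ) (hx : a ≤ x) :
    HasDerivAt (fun x => ((x - a) + 2 / (1 + (x - a))) * gaussWeight a x)
      ((1 - 2 / (1 + (x - a)) ^ 2 - (x - a) * ((x - a) + 2 / (1 + (x - a)))) *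
        gaussWeight a x) x := by
  have hy : (1 + (x - a)) ≠ 0 := by linarith
  have h1 : HasDerivAt (fun x => x - a) 1 x := (hasDerivAt_id x).sub_const a
  have h2 : HasDerivAt (fun x => gaussWeight a x) (gaussWeight a x * (-(x - a))) x := by
    have := ((h1.fun_pow 2).fun_neg.div_const 2).exp
    unfold gaussWeight
    convert this using 1
    push_cast
    ring
  have h3 := (h1.fun_add ((hasDerivAt_const x (2 : ℝ)).fun_div (h1.const_add 1) hy)).fun_mul h2
  refine h3.congr_deriv ?_
  field_simp
  ring

/-- Hardy-type inequality for the Gaussian weight on a bounded interval starting at its centre. -/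
theorem integral_sq_mul_gaussWeight_le {f : ℝ → ℝ} {a X : ℝ} (hX : a ≤ X)
    (hf : AbsolutelyContinuousOnInterval f a X)
    (hi : IntervalIntegrable (fun x => deriv f x ^ 2 * gaussWeight a x) volume a X) :
    ∫ x in a..X, f x ^ 2 * ((x - a) ^ 2 + 1 / 2) * gaussWeight a x ≤
      4 * f a ^ 2 + 32 * ∫ x in a..X, deriv f x ^ 2 * gaussWeight a x := by
  -- With `y = x - a`, the choice `k = y` would give `-(k w)' = (y² - 1) w`, negative near the
  -- centre. The correction `2 / (1 + y)` raises this to at least `(y² + 1/2) w` while keeping `k² ≤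
  -- y² + 4`.
  set k : ℝ → ℝ := fun x => (x - a) + 2 / (1 + (x - a)) with hk
  set k' : ℝ → ℝ := fun x => 1 - 2 / (1 + (x - a)) ^ 2 with hk'
  set w := gaussWeight a with hw
  have hwc : Continuous w := continuous_gaussWeight a
  have hne : ∀ x ∈ uIcc a X, 1 + (x - a) ≠ 0 := by
    intro x hx
    rw [uIcc_of_le hX] at hx
    linarith [hx.1]
  have hψ : ∀ x ∈ uIcc a X, HasDerivAt (fun x => k x * w x)
      ((k' x - (x - a) * k x) * w x) x := by
    intro x hx
    rw [uIcc_of_le hX] at hx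
    exact hasDerivAt_hardyWeight a x hx.1
  have hkc : ContinuousOn k (uIcc a X) := by
    apply ContinuousOn.add (by fun_prop)
    exact ContinuousOn.div (by fun_prop) (by fun_prop) hne
  have hk'c : ContinuousOn k' (uIcc a X) := by
    apply ContinuousOn.sub (by fun_prop)
    exact ContinuousOn.div (by fun_prop) (by fun_prop) fun x hx => pow_ne_zero 2 (hne x hx)
  have hkd : ContDiffOn ℝ 1 (fun x => k x * w x) (uIcc a X) := by
    apply ContDiffOn.mul
    · apply ContDiffOn.add (by fun_prop)
      exact ContDiffOn.div (by fun_prop) (by fun_prop) hne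
    · exact (contDiff_gaussWeight a).contDiffOn
  have hψac := hkd.absolutelyContinuousOnInterval
  have hibp := (hf.fun_mul hf).integral_mul_deriv_eq_deriv_mul hψac
  have hfc := hf.continuousOn
  have hfi := hf.intervalIntegrable_deriv
  have hdi : IntervalIntegrable (fun x => 2 * (f x * deriv f x) * (k x * w x)) volume a X :=
    ((hfi.continuousOn_mul hfc).const_mul 2).mul_continuousOn (hkc.mul hwc.continuousOn)
  have h1 : ∫ x in a..X, f x * f x * deriv (fun x => k x * w x) x =
      ∫ x in a..X, f x * f x * ((k' x - (x - a) * k x) * w x) :=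
    intervalIntegral.integral_congr fun x hx => by simp only [(hψ x hx).deriv]
  have h2 : ∫ x in a..X, deriv (fun x => f x * f x) x * (k x * w x) =
      ∫ x in a..X, 2 * (f x * deriv f x) * (k x * w x) := by
    apply intervalIntegral.integral_congr_ae
    filter_upwards [hf.ae_differentiableAt] with x hx hx'
    have := (hx (uIoc_subset_uIcc hx')).hasDerivAt
    rw [(this.fun_mul this).deriv]
    ring
  rw [h1, h2] at hibp
  have hψX : 0 ≤ f X * f X * (k X * w X) := by
    have : 0 ≤ X - a := by linarith
    have := gaussWeight_pos a X
    refine mul_nonneg (mul_self_nonneg _) (mul_nonneg ?_ this.le)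
    simp only [hk]
    positivity
  have hψa : k a * w a = 2 := by simp [hk, hw, gaussWeight]
  have hki : IntervalIntegrable (fun x => f x * f x * ((k' x - (x - a) * k x) * w x)) volume a X :=
    ((hfc.mul hfc).mul ((hk'c.sub (ContinuousOn.mul (by fun_prop) hkc)).mul
      hwc.continuousOn)).intervalIntegrable
  -- The last two terms on the right form `-(f² k w)'`. Young's inequality with weight 16 costs `f²
  -- k² / 16 ≤ f² (y² / 16 + 1/4)`, which fits in half of `f² (y² + 1/2)`.
  have hmono : ∫ x in a..X, 1 / 2 * (f x ^ 2 * ((x - a) ^ 2 + 1 / 2) * w x) ≤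
      ∫ x in a..X, (16 * (deriv f x ^ 2 * w x) -
        2 * (f x * deriv f x) * (k x * w x) - f x * f x * ((k' x - (x - a) * k x) * w x)) := by
    refine intervalIntegral.integral_mono_on hX ?_ (((hi.const_mul _).sub hdi).sub hki) ?_
    · apply ContinuousOn.intervalIntegrable
      exact continuousOn_const.mul (((hfc.pow 2).mul (by fun_prop)).mul hwc.continuousOn)
    · intro x hx
      have hy : 0 ≤ x - a := by linarith [hx.1]
      have hwx := gaussWeight_pos a x
      simp only [hk, hk']
      set y := x - a
      have e1 : y ^ 2 + 1 / 2 ≤ -(1 - 2 / (1 + y) ^ 2 - y * (y + 2 / (1 + y))) := by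
        have : -(1 - 2 / (1 + y) ^ 2 - y * (y + 2 / (1 + y))) - (y ^ 2 + 1 / 2) =
            (y - 1) ^ 2 / (2 * (1 + y) ^ 2) := by
          field_simp
          ring
        have : 0 ≤ (y - 1) ^ 2 / (2 * (1 + y) ^ 2) := by positivity
        linarith
      have e2 : (y + 2 / (1 + y)) ^ 2 ≤ y ^ 2 + 4 := by
        have : y ^ 2 + 4 - (y + 2 / (1 + y)) ^ 2 = 4 * y / (1 + y) ^ 2 := by
          field_simp
          ring
        have : 0 ≤ 4 * y / (1 + y) ^ 2 := by positivity
        linarith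
      set q := y + 2 / (1 + y)
      have e3 : 0 ≤ (4 * deriv f x - f x * q / 4) ^ 2 := sq_nonneg _
      have e4 := mul_le_mul_of_nonneg_left e1 (sq_nonneg (f x))
      have e5 := mul_le_mul_of_nonneg_left e2 (sq_nonneg (f x))
      have e6 : 1 / 2 * (f x ^ 2 * (y ^ 2 + 1 / 2)) ≤
          -(f x ^ 2 * (1 - 2 / (1 + y) ^ 2 - y * q)) - 2 * (f x * deriv f x) * q +
            16 * deriv f x ^ 2 := by
        nlinarith
      have e7 := mul_le_mul_of_nonneg_right e6 hwx.le
      simp only [hw]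
      linarith
  rw [intervalIntegral.integral_const_mul, intervalIntegral.integral_sub
    ((hi.const_mul _).sub hdi) hki, intervalIntegral.integral_sub (hi.const_mul _) hdi,
    intervalIntegral.integral_const_mul] at hmono
  rw [hψa] at hibp
  linarith

/-- Hardy-type inequality for the Gaussian weight on a half-line starting at its centre. -/
theorem integrableOn_sq_mul_gaussWeight {f : ℝ → ℝ} {a M : ℝ}
    (hf : ∀ a b : ℝ, AbsolutelyContinuousOnInterval f a b)
    (hi : IntegrableOn (fun x => deriv f x ^ 2 * gaussWeight a x) (Ioi a))
    (hM : ∫ x in Ioi a, deriv f x ^ 2 * gaussWeight a x ≤ M) :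
    IntegrableOn (fun x => f x ^ 2 * ((x - a) ^ 2 + 1 / 2) * gaussWeight a x) (Ioi a) ∧
      ∫ x in Ioi a, f x ^ 2 * ((x - a) ^ 2 + 1 / 2) * gaussWeight a x ≤
        4 * f a ^ 2 + 32 * M := by
  have hfc := continuous_of_absolutelyContinuousOnInterval hf
  have hwc := continuous_gaussWeight a
  have hc : Continuous (fun x => f x ^ 2 * ((x - a) ^ 2 + 1 / 2) * gaussWeight a x) := by fun_prop
  have hbound : ∀ X, a ≤ X → ∫ x in a..X, f x ^ 2 * ((x - a) ^ 2 + 1 / 2) * gaussWeight a x ≤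
      4 * f a ^ 2 + 32 * M := by
    intro X hX
    have hsub : IntegrableOn (fun x => deriv f x ^ 2 * gaussWeight a x) (Ioc a X) :=
      hi.mono_set Ioc_subset_Ioi_self
    have h1 := integral_sq_mul_gaussWeight_le hX (hf a X)
      ((intervalIntegrable_iff_integrableOn_Ioc_of_le hX).2 hsub)
    have h2 : ∫ x in a..X, deriv f x ^ 2 * gaussWeight a x ≤ M := by
      rw [intervalIntegral.integral_of_le hX]
      refine le_trans (setIntegral_mono_set hi ?_ Ioc_subset_Ioi_self.eventuallyLE) hM
      exact Eventually.of_forall fun x => mul_nonneg (sq_nonneg _) (gaussWeight_pos a x).le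
    linarith
  have hint : IntegrableOn (fun x => f x ^ 2 * ((x - a) ^ 2 + 1 / 2) * gaussWeight a x)
      (Ioi a) := by
    refine integrableOn_Ioi_of_intervalIntegral_norm_bounded (4 * f a ^ 2 + 32 * M) a
      (b := id) (l := atTop) (fun X => (hc.integrableOn_Icc).mono_set Ioc_subset_Icc_self)
      tendsto_id ?_
    filter_upwards [eventually_ge_atTop a] with X hX
    refine le_trans (le_of_eq ?_) (hbound X hX)
    refine intervalIntegral.integral_congr fun x _ => ?_
    exact Real.norm_of_nonneg (mul_nonneg (mul_nonneg (sq_nonneg _) (by positivity))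
      (gaussWeight_pos a x).le)
  refine ⟨hint, ?_⟩
  refine le_of_tendsto (intervalIntegral_tendsto_integral_Ioi a hint tendsto_id) ?_
  filter_upwards [eventually_ge_atTop a] with X hX using hbound X hX

/-! ### Growth of increments away from the origin -/

/-- The order of magnitude of the Poincaré constant of the mixture of two unit Gaussians centred
at `±a`. -/
noncomputable def barrier (a : ℝ) : ℝ := Real.exp (a ^ 2 / 2) / a

theorem one_le_barrier {a : ℝ} (ha : 1 ≤ a) : 1 ≤ barrier a := by
  unfold barrier
  rw [one_le_div (by linarith)]
  have := Real.add_one_le_exp (a ^ 2 / 2)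
  nlinarith [sq_nonneg (a - 1)]

/-- On `[0, a]`, `(a - t)² ≤ a (a - t)` replaces the Gaussian exponent by a linear one, which
integrates explicitly. -/
theorem integral_inv_gaussWeight_le_barrier {a x : ℝ} (ha : 0 < a) (hx : 0 ≤ x) (hxa : x ≤ a) :
    ∫ t in (0 : ℝ)..x, (gaussWeight a t)⁻¹ ≤ 2 * barrier a := by
  have hd : ∀ t ∈ uIcc 0 x, HasDerivAt
      (fun t => -(2 / a) * Real.exp (a * (a - t) / 2)) (Real.exp (a * (a - t) / 2)) t := by
    intro t _
    have h := ((((hasDerivAt_id t).const_sub a).const_mul a).div_const 2).exp.const_mul (-(2 / a))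
    refine h.congr_deriv ?_
    simp only [id]
    field_simp
  have hc : Continuous fun t => (gaussWeight a t)⁻¹ :=
    (continuous_gaussWeight a).inv₀ fun x => (gaussWeight_pos a x).ne'
  calc ∫ t in (0 : ℝ)..x, (gaussWeight a t)⁻¹ ≤ ∫ t in (0 : ℝ)..x, Real.exp (a * (a - t) / 2) := by
        refine intervalIntegral.integral_mono_on hx (hc.intervalIntegrable _ _)
          (Continuous.intervalIntegrable (by fun_prop) _ _) fun t ht => ?_
        rw [gaussWeight, ← Real.exp_neg]
        apply Real.exp_le_exp.2
        nlinarith [ht.1, ht.2]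
    _ = -(2 / a) * Real.exp (a * (a - x) / 2) - -(2 / a) * Real.exp (a * (a - 0) / 2) :=
        intervalIntegral.integral_eq_sub_of_hasDerivAt hd
          (Continuous.intervalIntegrable (by fun_prop) _ _)
    _ ≤ 2 * barrier a := by
        have h1 : 0 ≤ 2 / a * Real.exp (a * (a - x) / 2) := by positivity
        have h2 : 2 / a * Real.exp (a * (a - 0) / 2) = 2 * barrier a := by
          rw [barrier, sub_zero, ← sq]; ring
        linarith

/-- Past `a` the integrand increases, so the extra piece is at most `(x - a) exp ((x - a)² / 2) ≤
exp ((x - a)²)`. The crude exponent is harmless: it is only used under a logarithm. -/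
theorem integral_inv_gaussWeight_le {a x : ℝ} (ha : 1 ≤ a) (hxa : a ≤ x) :
    ∫ t in (0 : ℝ)..x, (gaussWeight a t)⁻¹ ≤ 3 * barrier a * Real.exp ((x - a) ^ 2) := by
  have hc : Continuous fun t => (gaussWeight a t)⁻¹ :=
    (continuous_gaussWeight a).inv₀ fun x => (gaussWeight_pos a x).ne'
  rw [← intervalIntegral.integral_add_adjacent_intervals (hc.intervalIntegrable 0 a)
    (hc.intervalIntegrable a x)]
  have h1 := integral_inv_gaussWeight_le_barrier (a := a) (by linarith) (by linarith) le_rfl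
  have h2 : ∫ t in a..x, (gaussWeight a t)⁻¹ ≤ ∫ _t in a..x, Real.exp ((x - a) ^ 2 / 2) := by
    refine intervalIntegral.integral_mono_on hxa (hc.intervalIntegrable _ _)
      (by simp) fun t ht => ?_
    rw [gaussWeight, ← Real.exp_neg]
    apply Real.exp_le_exp.2
    nlinarith [ht.1, ht.2]
  rw [intervalIntegral.integral_const, smul_eq_mul] at h2
  have h3 : x - a ≤ Real.exp ((x - a) ^ 2 / 2) := by
    have := Real.add_one_le_exp ((x - a) ^ 2 / 2)
    nlinarith [sq_nonneg (x - a - 1)]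
  have h4 : Real.exp ((x - a) ^ 2) = Real.exp ((x - a) ^ 2 / 2) * Real.exp ((x - a) ^ 2 / 2) := by
    rw [← Real.exp_add]; ring_nf
  have h5 : (1 : ℝ) ≤ Real.exp ((x - a) ^ 2) := Real.one_le_exp (sq_nonneg _)
  have h6 := one_le_barrier ha
  have h7 := mul_le_mul_of_nonneg_right h3 (Real.exp_pos ((x - a) ^ 2 / 2)).le
  nlinarith

section HalfLine

variable {f : ℝ → ℝ} {a M : ℝ}

theorem sq_sub_le_of_integral_le (hf : ∀ a b : ℝ, AbsolutelyContinuousOnInterval f a b)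
    (hi : IntegrableOn (fun x => deriv f x ^ 2 * gaussWeight a x) (Ioi 0))
    (hM : ∫ x in Ioi 0, deriv f x ^ 2 * gaussWeight a x ≤ M) {x : ℝ} (hx : 0 ≤ x) :
    (f x - f 0) ^ 2 ≤ M * ∫ t in (0 : ℝ)..x, (gaussWeight a t)⁻¹ := by
  have h := sq_sub_le_integral_mul_integral hx (hf 0 x) (continuous_gaussWeight a)
    (gaussWeight_pos a) ((intervalIntegrable_iff_integrableOn_Ioc_of_le hx).2
      (hi.mono_set Ioc_subset_Ioi_self))
  refine h.trans (mul_le_mul_of_nonneg_right ?_ ?_)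
  · rw [intervalIntegral.integral_of_le hx]
    refine le_trans (setIntegral_mono_set hi ?_ Ioc_subset_Ioi_self.eventuallyLE) hM
    exact Eventually.of_forall fun x => mul_nonneg (sq_nonneg _) (gaussWeight_pos a x).le
  · exact intervalIntegral.integral_nonneg hx fun t _ => (inv_pos.2 (gaussWeight_pos a t)).le

/-- Hardy for `f - f 0`: the boundary term costs `4 · 2 K M`, and `32 M ≤ 32 K M` since `K ≥ 1`. -/
theorem integrableOn_sq_sub_mul_gaussWeight (ha : 1 ≤ a)
    (hf : ∀ a b : ℝ, AbsolutelyContinuousOnInterval f a b)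
    (hi : IntegrableOn (fun x => deriv f x ^ 2 * gaussWeight a x) (Ioi 0))
    (hM : ∫ x in Ioi 0, deriv f x ^ 2 * gaussWeight a x ≤ M) :
    IntegrableOn (fun x => (f x - f 0) ^ 2 * ((x - a) ^ 2 + 1 / 2) * gaussWeight a x) (Ioi a) ∧
      ∫ x in Ioi a, (f x - f 0) ^ 2 * ((x - a) ^ 2 + 1 / 2) * gaussWeight a x ≤
        40 * barrier a * M := by
  have hd : ∀ x, deriv (fun x => f x - f 0) x = deriv f x := fun x => deriv_sub_const _
  have hg : ∀ c d : ℝ, AbsolutelyContinuousOnInterval (fun x => f x - f 0) c d := fun c d =>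
    (hf c d).fun_sub (LipschitzWith.const (f 0)).lipschitzOnWith.absolutelyContinuousOnInterval
  have hsub : Ioi a ⊆ Ioi 0 := Ioi_subset_Ioi (by linarith)
  have hpos : 0 ≤ fun x => deriv f x ^ 2 * gaussWeight a x :=
    fun x => mul_nonneg (sq_nonneg _) (gaussWeight_pos a x).le
  have h := integrableOn_sq_mul_gaussWeight (f := fun x => f x - f 0) (a := a) (M := M) hg
    (by simpa only [hd] using hi.mono_set hsub) (by
      simp only [hd]
      exact (setIntegral_mono_set hi (Eventually.of_forall hpos) hsub.eventuallyLE).trans hM)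
  refine ⟨h.1, h.2.trans ?_⟩
  have hM0 : 0 ≤ M := (integral_nonneg hpos).trans hM
  have h1 := sq_sub_le_of_integral_le hf hi hM (x := a) (by linarith)
  have h2 := integral_inv_gaussWeight_le_barrier (a := a) (by linarith) (by linarith) le_rfl
  have h3 := one_le_barrier ha
  have h4 := mul_le_mul_of_nonneg_left h2 hM0
  nlinarith [mul_le_mul_of_nonneg_left h3 hM0]

end HalfLine

/-! ### Variational bound for the entropy -/

/-- The integrand of the variational formula for the entropy of `f²`, as a function of the value
`y` of `f` and of the comparison level `τ`. -/
noncomputable def entropyIntegrand (τ y : ℝ) : ℝ := y ^ 2 * Real.log (y ^ 2 / τ ^ 2) - y ^ 2 + τ ^ 2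

theorem entropyIntegrand_nonneg {τ : ℝ} (hτ : 0 < τ) (y : ℝ) : 0 ≤ entropyIntegrand τ y := by
  unfold entropyIntegrand
  rcases eq_or_ne y 0 with rfl | hy
  · simp; positivity
  have h1 : 0 < y ^ 2 / τ ^ 2 := by positivity
  have h := Real.one_sub_inv_le_log_of_pos h1
  have h2 := mul_le_mul_of_nonneg_left h (sq_nonneg y)
  have h3 : y ^ 2 * (1 - (y ^ 2 / τ ^ 2)⁻¹) = y ^ 2 - τ ^ 2 := by
    field_simp
  linarith

/-- For `y ≤ 3 τ`, `log u ≤ u - 1` makes the integrand quadratic in `y - τ`. For `y > 3 τ`, `y` is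
comparable to `y - m` and the growth hypothesis bounds the logarithm by `log 36 + z`. The
coefficient `41 = 32 + 9` covers both regimes. -/
theorem entropyIntegrand_le {m Q y z : ℝ} (hm : 0 ≤ m) (hQ : 0 < Q) (hy : 0 ≤ y) (hz : 0 ≤ z)
    (h : (y - m) ^ 2 ≤ 16 * Q ^ 2 * Real.exp z) :
    entropyIntegrand (m + Q) y ≤ 32 * Q ^ 2 + (y - m) ^ 2 * (41 + 9 / 4 * z) := by
  set τ := m + Q with hτdef
  have hτ : 0 < τ := by positivity
  unfold entropyIntegrand
  rcases eq_or_lt_of_le hy with rfl | hy0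
  · have : τ ^ 2 ≤ 2 * (m ^ 2 + Q ^ 2) := by
      simp only [hτdef]; nlinarith [sq_nonneg (m - Q)]
    have h2 : 0 ≤ m ^ 2 * (9 / 4 * z) := by positivity
    simp
    nlinarith [sq_nonneg m]
  have h0 : 0 ≤ (y - m) ^ 2 * (9 / 4 * z) := by positivity
  rcases le_or_gt y (3 * τ) with hyτ | hyτ
  · have hlog := Real.log_le_sub_one_of_pos (show 0 < y ^ 2 / τ ^ 2 by positivity)
    have h1 := mul_le_mul_of_nonneg_left hlog (sq_nonneg y)
    have h2 : y ^ 2 * (y ^ 2 / τ ^ 2 - 1) - y ^ 2 + τ ^ 2 = (y - τ) ^ 2 * ((y + τ) / τ) ^ 2 := by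
      field_simp
      ring
    have h3 : (y + τ) / τ ≤ 4 := by
      rw [div_le_iff₀ hτ]; linarith
    have h4 : ((y + τ) / τ) ^ 2 ≤ 4 ^ 2 := pow_le_pow_left₀ (by positivity) h3 2
    have h5 := mul_le_mul_of_nonneg_left h4 (sq_nonneg (y - τ))
    have h6 : (y - τ) ^ 2 ≤ 2 * ((y - m) ^ 2 + Q ^ 2) := by
      simp only [hτdef]; nlinarith [sq_nonneg (y - m + Q)]
    nlinarith [sq_nonneg (y - m)]
  · have h1 : y ≤ 3 / 2 * (y - m) := by linarith
    have h2 : y ^ 2 ≤ 9 / 4 * (y - m) ^ 2 := by nlinarith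
    have h3 : y ^ 2 / τ ^ 2 ≤ 36 * Real.exp z := by
      rw [div_le_iff₀ (by positivity)]
      have : Q ^ 2 ≤ τ ^ 2 := pow_le_pow_left₀ hQ.le (by linarith) 2
      nlinarith [Real.exp_pos z]
    have h4 : Real.log (y ^ 2 / τ ^ 2) ≤ 4 + z := by
      refine (Real.log_le_log (by positivity) h3).trans ?_
      rw [Real.log_mul (by norm_num) (Real.exp_pos z).ne', Real.log_exp]
      have : Real.log 36 ≤ 4 := by
        rw [Real.log_le_iff_le_exp (by norm_num)]
        have h := Real.exp_one_gt_d9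
        have h' : Real.exp 4 = Real.exp 1 ^ 4 := by rw [← Real.exp_nat_mul]; norm_num
        rw [h']
        have : (2.7 : ℝ) ^ 4 ≤ Real.exp 1 ^ 4 := pow_le_pow_left₀ (by norm_num) (by linarith) 4
        norm_num at this ⊢
        linarith
      linarith
    have h5 := mul_le_mul_of_nonneg_left h4 (sq_nonneg y)
    have h6 := mul_le_mul_of_nonneg_right h2 (show 0 ≤ 4 + z by linarith)
    have h7 : τ ^ 2 ≤ y ^ 2 := pow_le_pow_left₀ hτ.le (by linarith) 2
    nlinarith [sq_nonneg (y - m), sq_nonneg Q]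

/-- Variational bound for the entropy. -/
theorem integrable_and_entropy_le {μ : Measure ℝ} [IsProbabilityMeasure μ] {f : ℝ → ℝ} {τ : ℝ}
    (hτ : 0 < τ) (hf : Integrable (fun x => f x ^ 2) μ)
    (hF : Integrable (fun x => entropyIntegrand τ (f x)) μ) :
    Integrable (fun x => f x ^ 2 * Real.log (f x ^ 2 / ∫ y, f y ^ 2 ∂μ)) μ ∧
      entropy μ (fun x => f x ^ 2) ≤ ∫ x, entropyIntegrand τ (f x) ∂μ := by
  unfold entropy
  set G := ∫ y, f y ^ 2 ∂μ with hG
  have hG0 : 0 ≤ G := integral_nonneg fun x => sq_nonneg _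
  have hFnn : 0 ≤ ∫ x, entropyIntegrand τ (f x) ∂μ :=
    integral_nonneg fun x => entropyIntegrand_nonneg hτ _
  rcases eq_or_lt_of_le hG0 with h0 | hpos
  -- Here division by zero and `Real.log 0` are both `0`, so the entropy vanishes.
  · rw [← h0]
    simpa using hFnn
  have heq : ∀ x, f x ^ 2 * Real.log (f x ^ 2 / G) =
      entropyIntegrand τ (f x) + f x ^ 2 * (1 + Real.log (τ ^ 2 / G)) - τ ^ 2 := by
    intro x
    unfold entropyIntegrand
    rcases eq_or_ne (f x) 0 with h | h
    · simp [h]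
    have hτ' := hτ.ne'
    rw [Real.log_div (by positivity) hpos.ne', Real.log_div (by positivity) (by positivity),
      Real.log_div (by positivity) hpos.ne']
    ring
  simp only [heq]
  have hi : Integrable (fun x => entropyIntegrand τ (f x) +
      f x ^ 2 * (1 + Real.log (τ ^ 2 / G))) μ := hF.add (hf.mul_const _)
  refine ⟨hi.sub (integrable_const _), ?_⟩
  rw [integral_sub hi (integrable_const _), integral_add hF (hf.mul_const _), integral_mul_const,
    ← hG]
  simp only [integral_const, probReal_univ, smul_eq_mul, one_mul]
  have h := Real.log_le_sub_one_of_pos (show 0 < τ ^ 2 / G by positivity)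
  have h2 := mul_le_mul_of_nonneg_left h hG0
  have h3 : G * (τ ^ 2 / G - 1) = τ ^ 2 - G := by field_simp
  linarith

/-! ### The Gaussian mixture -/

/-- The density of the mixture of two unit Gaussians centred at `±a`. -/
noncomputable def mixtureDensity (a x : ℝ) : ℝ :=
  (gaussWeight a x + gaussWeight (-a) x) / (2 * √(2 * Real.pi))

/-- The mixture of two unit Gaussians centred at `±a`. -/
noncomputable def gaussianMixture (a : ℝ) : Measure ℝ :=
  volume.withDensity fun x => ENNReal.ofReal (mixtureDensity a x)

theorem two_le_sqrt_two_pi : 2 ≤ √(2 * Real.pi) :=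
  Real.le_sqrt_of_sq_le (by linarith [Real.pi_gt_three])

theorem sqrt_two_pi_le : √(2 * Real.pi) ≤ 8 / 3 := by
  rw [Real.sqrt_le_left (by norm_num)]
  linarith [Real.pi_lt_d2]

theorem mixtureDensity_pos (a x : ℝ) : 0 < mixtureDensity a x := by
  have := gaussWeight_pos a x
  have := gaussWeight_pos (-a) x
  unfold mixtureDensity
  positivity

theorem continuous_mixtureDensity (a : ℝ) : Continuous (mixtureDensity a) := by
  have := continuous_gaussWeight a
  have := continuous_gaussWeight (-a)
  unfold mixtureDensity
  fun_prop

theorem mixtureDensity_neg (a x : ℝ) : mixtureDensity a (-x) = mixtureDensity a x := by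
  unfold mixtureDensity gaussWeight
  rw [add_comm]
  congr 4 <;> ring

theorem gaussWeight_le_mixtureDensity (a x : ℝ) :
    gaussWeight a x ≤ 2 * √(2 * Real.pi) * mixtureDensity a x := by
  have := two_le_sqrt_two_pi
  unfold mixtureDensity
  rw [mul_div_cancel₀ _ (by positivity)]
  linarith [gaussWeight_pos (-a) x]

theorem mixtureDensity_le_gaussWeight {a x : ℝ} (ha : 0 ≤ a) (hx : 0 ≤ x) :
    mixtureDensity a x ≤ gaussWeight a x / √(2 * Real.pi) := by
  have h1 : gaussWeight (-a) x ≤ gaussWeight a x := by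
    apply Real.exp_le_exp.2
    nlinarith [mul_nonneg ha hx]
  have := two_le_sqrt_two_pi
  unfold mixtureDensity
  rw [div_le_div_iff₀ (by positivity) (by positivity)]
  nlinarith

theorem gaussianReal_eq_withDensity_gaussWeight (b : ℝ) :
    gaussianReal b 1 =
      volume.withDensity fun x => ENNReal.ofReal (gaussWeight b x / √(2 * Real.pi)) := by
  rw [gaussianReal_of_var_ne_zero _ one_ne_zero]
  congr 1
  funext x
  rw [gaussianPDF, gaussianPDFReal, gaussWeight]
  congr 1
  simp only [NNReal.coe_one, mul_one]
  exact (div_eq_inv_mul _ _).symm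

theorem gaussianMixture_eq (a : ℝ) :
    gaussianMixture a = (2⁻¹ : ENNReal) • (gaussianReal (-a) 1 + gaussianReal a 1) := by
  have hm : ∀ b : ℝ, Measurable fun x => ENNReal.ofReal (gaussWeight b x / √(2 * Real.pi)) :=
    fun b => ((continuous_gaussWeight b).measurable.div_const _).ennreal_ofReal
  rw [gaussianReal_eq_withDensity_gaussWeight, gaussianReal_eq_withDensity_gaussWeight,
    ← withDensity_add_left (hm _), ← withDensity_smul _ ((hm _).add (hm _)), gaussianMixture]
  congr 1
  funext x
  have h1 := gaussWeight_pos a x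
  have h2 := gaussWeight_pos (-a) x
  simp only [Pi.smul_apply, Pi.add_apply, smul_eq_mul]
  rw [← ENNReal.ofReal_add (by positivity) (by positivity), show (2⁻¹ : ENNReal) =
    ENNReal.ofReal 2⁻¹ by rw [ENNReal.ofReal_inv_of_pos two_pos]; simp,
    ← ENNReal.ofReal_mul (by positivity), mixtureDensity]
  congr 1
  field_simp
  ring

instance isProbabilityMeasure_gaussianMixture (a : ℝ) :
    IsProbabilityMeasure (gaussianMixture a) := by
  constructor
  rw [gaussianMixture_eq]
  simp only [Measure.smul_apply, Measure.add_apply, measure_univ, smul_eq_mul]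
  rw [one_add_one_eq_two, ENNReal.inv_mul_cancel (by norm_num) (by norm_num)]

theorem integrable_gaussianMixture_iff {a : ℝ} {g : ℝ → ℝ} :
    Integrable g (gaussianMixture a) ↔ Integrable fun x => g x * mixtureDensity a x := by
  rw [gaussianMixture, integrable_withDensity_iff_integrable_smul'
    (continuous_mixtureDensity a).measurable.ennreal_ofReal (by simp)]
  simp only [ENNReal.toReal_ofReal (mixtureDensity_pos a _).le, smul_eq_mul, mul_comm]

theorem integral_gaussianMixture (a : ℝ) (g : ℝ → ℝ) :
    ∫ x, g x ∂gaussianMixture a = ∫ x, g x * mixtureDensity a x := by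
  rw [gaussianMixture, integral_withDensity_eq_integral_toReal_smul
    (continuous_mixtureDensity a).measurable.ennreal_ofReal (by simp)]
  simp only [ENNReal.toReal_ofReal (mixtureDensity_pos a _).le, smul_eq_mul, mul_comm]

theorem integrable_mixtureDensity (a : ℝ) : Integrable (mixtureDensity a) := by
  simpa using integrable_gaussianMixture_iff.1 (integrable_const (1 : ℝ) (μ := gaussianMixture a))

theorem integral_mixtureDensity (a : ℝ) : ∫ x, mixtureDensity a x = 1 := by
  simpa using (integral_gaussianMixture a fun _ => 1).symm

/-! ### Upper bound for the mixture -/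

/-- Bound for the entropy integrand over the half-line containing one of the two centres. -/
theorem integrableOn_entropyIntegrand {f : ℝ → ℝ} {a E Q : ℝ} (ha : 1 ≤ a)
    (hf : ∀ a b : ℝ, AbsolutelyContinuousOnInterval f a b) (hnn : ∀ x, 0 ≤ f x)
    (hi : IntegrableOn (fun x => deriv f x ^ 2 * mixtureDensity a x) (Ioi 0))
    (hE : ∫ x in Ioi 0, deriv f x ^ 2 * mixtureDensity a x ≤ E) (hQ : 0 < Q)
    (hQE : barrier a * E ≤ Q ^ 2) :
    IntegrableOn (fun x => entropyIntegrand (f 0 + Q) (f x) * mixtureDensity a x) (Ioi 0) ∧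
      ∫ x in Ioi 0, entropyIntegrand (f 0 + Q) (f x) * mixtureDensity a x ≤ 7248 * Q ^ 2 := by
  have hc2 := two_le_sqrt_two_pi
  have hc3 := sqrt_two_pi_le
  set c := √(2 * Real.pi) with hc
  have hK := one_le_barrier ha
  set K := barrier a with hKdef
  have hE0 : 0 ≤ E := le_trans (integral_nonneg fun x =>
    mul_nonneg (sq_nonneg _) (mixtureDensity_pos a x).le) hE
  have hfc := continuous_of_absolutelyContinuousOnInterval hf
  have hwc := continuous_gaussWeight a
  have hpc := continuous_mixtureDensity a
  set M := 2 * c * E with hM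
  have hle : ∀ x, deriv f x ^ 2 * gaussWeight a x ≤
      2 * c * (deriv f x ^ 2 * mixtureDensity a x) := fun x => by
    have := mul_le_mul_of_nonneg_left (gaussWeight_le_mixtureDensity a x) (sq_nonneg (deriv f x))
    linarith
  have hwi : IntegrableOn (fun x => deriv f x ^ 2 * gaussWeight a x) (Ioi 0) := by
    refine (hi.const_mul (2 * c)).mono'
      (((measurable_deriv f).pow_const 2).mul hwc.measurable).aestronglyMeasurable
      (Eventually.of_forall fun x => ?_)
    rw [Real.norm_of_nonneg (mul_nonneg (sq_nonneg _) (gaussWeight_pos a x).le)]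
    exact hle x
  have hwM : ∫ x in Ioi 0, deriv f x ^ 2 * gaussWeight a x ≤ M := by
    refine (integral_mono hwi (hi.const_mul (2 * c)) hle).trans ?_
    rw [integral_const_mul]
    exact mul_le_mul_of_nonneg_left hE (by positivity)
  have hM0 : 0 ≤ M := by positivity
  -- `3 K M = 6 c K E` and `c ≤ 8 / 3`: the source of the 16 in `entropyIntegrand_le`.
  have hMQ : 3 * K * M ≤ 16 * Q ^ 2 := by
    have : 3 * K * M = 6 * c * (K * E) := by rw [hM]; ring
    have h0 : 0 ≤ K * E := by positivity
    rw [this]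
    nlinarith
  obtain ⟨hti, htle⟩ := integrableOn_sq_sub_mul_gaussWeight ha hf hwi hwM
  set t : ℝ → ℝ := fun x => (f x - f 0) ^ 2 * ((x - a) ^ 2 + 1 / 2) * gaussWeight a x with ht
  -- `688 = 32 + 16 · 41` is the bound before `a`; beyond it, `41 + 9/4 s ≤ 82 (s + 1/2)` with `s =
  -- (x - a)²` matches the Hardy weight.
  have hpt : ∀ x ∈ Ioi (0 : ℝ), entropyIntegrand (f 0 + Q) (f x) * mixtureDensity a x ≤
      688 * Q ^ 2 * mixtureDensity a x + (Ioi a).indicator (fun x => 82 / c * t x) x := by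
    intro x hx
    have hx0 : 0 ≤ x := le_of_lt hx
    have hp := mixtureDensity_pos a x
    have hinc := sq_sub_le_of_integral_le hf hwi hwM hx0
    rcases le_or_gt x a with hxa | hxa
    · rw [indicator_of_notMem (by simpa using hxa), add_zero]
      refine mul_le_mul_of_nonneg_right ?_ hp.le
      have h1 := mul_le_mul_of_nonneg_left
        (integral_inv_gaussWeight_le_barrier (by linarith) hx0 hxa) hM0
      have h2 : (f x - f 0) ^ 2 ≤ 16 * Q ^ 2 := by
        have : 0 ≤ K * M := by positivity
        linarith
      have := entropyIntegrand_le (z := 0) (hnn 0) hQ (hnn x) le_rfl (by simpa using h2)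
      linarith
    · rw [indicator_of_mem (mem_Ioi.2 hxa)]
      have h1 := mul_le_mul_of_nonneg_left (integral_inv_gaussWeight_le ha hxa.le) hM0
      have h2 : (f x - f 0) ^ 2 ≤ 16 * Q ^ 2 * Real.exp ((x - a) ^ 2) := by
        have := mul_le_mul_of_nonneg_right hMQ (Real.exp_pos ((x - a) ^ 2)).le
        linarith
      have h3 := entropyIntegrand_le (hnn 0) hQ (hnn x) (sq_nonneg (x - a)) h2
      have h4 : entropyIntegrand (f 0 + Q) (f x) ≤
          688 * Q ^ 2 + 82 * ((f x - f 0) ^ 2 * ((x - a) ^ 2 + 1 / 2)) := by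
        nlinarith [mul_nonneg (sq_nonneg (f x - f 0)) (sq_nonneg (x - a)), sq_nonneg Q]
      have h5 := mul_le_mul_of_nonneg_right h4 hp.le
      have h6 := mul_le_mul_of_nonneg_left (mixtureDensity_le_gaussWeight (zero_le_one.trans ha) hx0)
        (show 0 ≤ 82 * ((f x - f 0) ^ 2 * ((x - a) ^ 2 + 1 / 2)) by positivity)
      have h7 : 82 * ((f x - f 0) ^ 2 * ((x - a) ^ 2 + 1 / 2)) * (gaussWeight a x / c) =
          82 / c * t x := by rw [ht]; ring
      rw [← hc, h7] at h6
      change _ ≤ 688 * Q ^ 2 * mixtureDensity a x + 82 / c * t x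
      linarith
  have hsub : Ioi a ⊆ Ioi 0 := Ioi_subset_Ioi (by linarith)
  have hpi : IntegrableOn (fun x => 688 * Q ^ 2 * mixtureDensity a x) (Ioi 0) :=
    ((integrable_mixtureDensity a).const_mul _).integrableOn
  have hind : IntegrableOn ((Ioi a).indicator fun x => 82 / c * t x) (Ioi 0) :=
    ((integrable_indicator_iff measurableSet_Ioi).2 (hti.const_mul _)).integrableOn
  have hF : IntegrableOn (fun x => entropyIntegrand (f 0 + Q) (f x) * mixtureDensity a x)
      (Ioi 0) := by
    refine (hpi.add hind).mono' ?_ ?_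
    · have : Measurable fun x => entropyIntegrand (f 0 + Q) (f x) * mixtureDensity a x := by
        have := hfc.measurable
        have := hpc.measurable
        unfold entropyIntegrand
        fun_prop
      exact this.aestronglyMeasurable
    · refine (ae_restrict_iff' measurableSet_Ioi).2 (Eventually.of_forall fun x hx => ?_)
      rw [Real.norm_of_nonneg (mul_nonneg (entropyIntegrand_nonneg (by linarith [hnn 0]) _)
        (mixtureDensity_pos a x).le)]
      exact hpt x hx
  refine ⟨hF, (setIntegral_mono_on hF (hpi.add hind) measurableSet_Ioi hpt).trans ?_⟩
  have e1 : ∫ x in Ioi 0, 688 * Q ^ 2 * mixtureDensity a x ≤ 688 * Q ^ 2 := by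
    rw [integral_const_mul]
    have h := setIntegral_le_integral (s := Ioi 0) (integrable_mixtureDensity a)
      (Eventually.of_forall fun x => (mixtureDensity_pos a x).le)
    rw [integral_mixtureDensity] at h
    exact mul_le_of_le_one_right (by positivity) h
  have e2 : ∫ x in Ioi 0, (Ioi a).indicator (fun x => 82 / c * t x) x =
      82 / c * ∫ x in Ioi a, t x := by
    rw [setIntegral_indicator measurableSet_Ioi, inter_eq_self_of_subset_right hsub,
      integral_const_mul]
  have e3 : 82 / c * ∫ x in Ioi a, t x ≤ 6560 * Q ^ 2 := by
    refine (mul_le_mul_of_nonneg_left htle (by positivity)).trans ?_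
    have : 82 / c * (40 * K * M) = 6560 * (K * E) := by
      rw [hM]; field_simp; ring
    linarith
  rw [integral_add' hpi hind, e2]
  linarith

theorem integrable_of_integrableOn_Ioi_comp_neg {g : ℝ → ℝ} (h1 : IntegrableOn g (Ioi 0))
    (h2 : IntegrableOn (fun x => g (-x)) (Ioi 0)) :
    Integrable g ∧ ∫ x, g x = (∫ x in Ioi 0, g x) + ∫ x in Ioi 0, g (-x) := by
  have h3 : IntegrableOn g (Iio 0) := by
    have := (Measure.measurePreserving_neg (volume : Measure ℝ)).integrableOn_comp_preimage
      (Homeomorph.neg ℝ).measurableEmbedding (f := g) (s := Iio 0)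
    refine this.1 ?_
    have hs : (Neg.neg ⁻¹' Iio (0 : ℝ)) = Ioi 0 := by ext; simp
    rw [hs]
    exact h2
  have h4 : IntegrableOn g (Iic 0) := (integrableOn_Iic_iff_integrableOn_Iio).2 h3
  refine ⟨?_, ?_⟩
  · rw [← integrableOn_univ, ← Iic_union_Ioi (a := (0 : ℝ))]
    exact h4.union h1
  · rw [← intervalIntegral.integral_Iic_add_Ioi h4 h1, integral_comp_neg_Ioi, neg_zero, add_comm]

/-- The half-line bound applies to `f` and to its reflection with the same level `f 0 + Q`, so the
two halves add up: `14496 = 2 · 7248`. -/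
theorem satisfiesLSI_gaussianMixture {a : ℝ} (ha : 1 ≤ a) :
    SatisfiesLSI (gaussianMixture a) (14496 * barrier a) := by
  intro f hf
  have hK := one_le_barrier ha
  set E := energy (gaussianMixture a) f with hE
  have hE0 : 0 ≤ E := integral_nonneg fun x => sq_nonneg _
  have hEi : Integrable (fun x => deriv f x ^ 2 * mixtureDensity a x) :=
    integrable_gaussianMixture_iff.1 hf.memLp_deriv.integrable_sq
  have hEeq : E = ∫ x, deriv f x ^ 2 * mixtureDensity a x := integral_gaussianMixture a _
  have key : ∀ Q : ℝ, 0 < Q → barrier a * E ≤ Q ^ 2 →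
      Integrable (fun x => f x ^ 2 * Real.log (f x ^ 2 / ∫ y, f y ^ 2 ∂gaussianMixture a))
        (gaussianMixture a) ∧
      entropy (gaussianMixture a) (fun x => f x ^ 2) ≤ 14496 * Q ^ 2 := by
    intro Q hQ hQE
    have hpos : 0 ≤ᵐ[volume] fun x => deriv f x ^ 2 * mixtureDensity a x :=
      Eventually.of_forall fun x => mul_nonneg (sq_nonneg _) (mixtureDensity_pos a x).le
    have h1 := integrableOn_entropyIntegrand ha hf.absolutelyContinuous hf.nonneg hEi.integrableOn
      ((setIntegral_le_integral hEi hpos).trans_eq hEeq.symm) hQ hQE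
    have hd : ∀ x, deriv (fun x => f (-1 * x)) x ^ 2 * mixtureDensity a x =
        deriv f (-x) ^ 2 * mixtureDensity a (-x) := fun x => by
      simp only [neg_one_mul, mixtureDensity_neg]
      rw [deriv_comp_neg, neg_sq]
    have hEi' : Integrable (fun x => deriv (fun x => f (-1 * x)) x ^ 2 * mixtureDensity a x) := by
      simp only [hd]
      exact hEi.comp_neg
    have hle : ∫ x in Ioi 0, deriv (fun x => f (-1 * x)) x ^ 2 * mixtureDensity a x ≤ E := by
      refine (setIntegral_le_integral hEi' (Eventually.of_forall fun x =>
        mul_nonneg (sq_nonneg _) (mixtureDensity_pos a x).le)).trans_eq ?_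
      simp only [hd]
      rw [hEeq]
      exact integral_neg_eq_self (fun x => deriv f x ^ 2 * mixtureDensity a x) volume
    have h2 := integrableOn_entropyIntegrand ha
      (absolutelyContinuousOnInterval_comp_mul hf.absolutelyContinuous (-1))
      (fun x => hf.nonneg _) hEi'.integrableOn hle hQ hQE
    have hneg : ∀ x, entropyIntegrand (f (-1 * 0) + Q) (f (-1 * x)) * mixtureDensity a x =
        entropyIntegrand (f 0 + Q) (f (-x)) * mixtureDensity a (-x) := fun x => by
      rw [mixtureDensity_neg, mul_zero, neg_one_mul]
    simp only [hneg] at h2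
    obtain ⟨h3, h4⟩ := integrable_of_integrableOn_Ioi_comp_neg h1.1 h2.1
    have h5 := integrable_and_entropy_le (μ := gaussianMixture a) (f := f) (τ := f 0 + Q)
      (by linarith [hf.nonneg 0]) hf.memLp.integrable_sq (integrable_gaussianMixture_iff.2 h3)
    refine ⟨h5.1, h5.2.trans ?_⟩
    rw [integral_gaussianMixture, h4]
    linarith [h1.2, h2.2]
  -- The energy may vanish but `Q` must be positive, hence `Q² = K E + ε` with `ε` arbitrary.
  have key2 : ∀ ε : ℝ, 0 < ε → _ := fun ε hε => key (√(barrier a * E + ε)) (by positivity)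
    (by rw [Real.sq_sqrt (by positivity)]; linarith)
  refine ⟨(key2 1 one_pos).1, le_of_forall_pos_le_add fun ε hε => ?_⟩
  have h := (key2 (ε / 14496) (by positivity)).2
  rw [Real.sq_sqrt (by positivity)] at h
  linarith

/-! ### Lower bound from a ramp -/

theorem integral_Ioi_gaussWeight (a : ℝ) :
    ∫ x in Ioi a, gaussWeight a x = √(2 * Real.pi) / 2 := by
  have h := integral_gaussian_Ioi (1 / 2)
  have h1 := (measurePreserving_sub_right (volume : Measure ℝ) a).setIntegral_preimage_emb
    (Homeomorph.subRight a).measurableEmbedding (fun x => Real.exp (-(1 / 2) * x ^ 2)) (Ioi 0)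
  have hs : ((fun x => x - a) ⁻¹' Ioi (0 : ℝ)) = Ioi a := by ext; simp
  rw [hs, h] at h1
  rw [show 2 * Real.pi = Real.pi / (1 / 2) by ring, ← h1]
  refine integral_congr_ae (Eventually.of_forall fun x => ?_)
  simp only [gaussWeight]
  ring_nf

theorem quarter_le_integral_Ioi_mixtureDensity (a : ℝ) :
    1 / 4 ≤ ∫ x in Ioi a, mixtureDensity a x := by
  have hc := two_le_sqrt_two_pi
  have hi := integral_Ioi_gaussWeight a
  have hp := (integrable_mixtureDensity a).const_mul (2 * √(2 * Real.pi))
  have hgi : Integrable (gaussWeight a) := by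
    refine hp.mono' (continuous_gaussWeight a).aestronglyMeasurable
      (Eventually.of_forall fun x => ?_)
    rw [Real.norm_of_nonneg (gaussWeight_pos a x).le]
    exact gaussWeight_le_mixtureDensity a x
  have h := setIntegral_mono (s := Ioi a) hgi.integrableOn hp.integrableOn
    (gaussWeight_le_mixtureDensity a)
  rw [hi, integral_const_mul] at h
  have hpos : 0 < √(2 * Real.pi) := by linarith
  nlinarith

theorem integral_Ioi_zero_mixtureDensity (a : ℝ) :
    ∫ x in Ioi 0, mixtureDensity a x = 1 / 2 := by
  have hi := integrable_mixtureDensity a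
  have h := (integrable_of_integrableOn_Ioi_comp_neg hi.integrableOn
    hi.comp_neg.integrableOn).2
  simp only [mixtureDensity_neg, integral_mixtureDensity] at h
  linarith

/-- The two Gaussians contribute factors at most `e` and `1`, and `e + 1 < 4 ≤ 2 √(2π)`. -/
theorem mixtureDensity_le_near_zero {a x : ℝ} (hx : 0 ≤ x) (hax : a * x ≤ 1) (ha : 0 ≤ a) :
    mixtureDensity a x ≤ Real.exp (-(a ^ 2 / 2)) := by
  have hc := two_le_sqrt_two_pi
  have h1 : gaussWeight a x ≤ Real.exp (-(a ^ 2 / 2)) * Real.exp 1 := by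
    rw [← Real.exp_add]
    exact Real.exp_le_exp.2 (by nlinarith [sq_nonneg x])
  have h2 : gaussWeight (-a) x ≤ Real.exp (-(a ^ 2 / 2)) :=
    Real.exp_le_exp.2 (by nlinarith [sq_nonneg x, mul_nonneg ha hx])
  have h3 := Real.exp_one_lt_d9
  have h4 := Real.exp_pos (-(a ^ 2 / 2))
  unfold mixtureDensity
  rw [div_le_iff₀ (by positivity)]
  nlinarith

/-- The ramp from `0` to `1` on `[0, 1 / a]`. -/
noncomputable def ramp (a x : ℝ) : ℝ := min 1 (max 0 (a * x))

theorem ramp_nonneg (a x : ℝ) : 0 ≤ ramp a x := le_min zero_le_one (le_max_left _ _)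

theorem ramp_le_one (a x : ℝ) : ramp a x ≤ 1 := min_le_left _ _

theorem lipschitzWith_ramp {a : ℝ} (ha : 0 ≤ a) : LipschitzWith a.toNNReal (ramp a) := by
  have h : LipschitzWith a.toNNReal (fun x => a * x) :=
    LipschitzWith.of_dist_le_mul fun x y => by
      rw [Real.dist_eq, Real.dist_eq, ← mul_sub, abs_mul, abs_of_nonneg ha,
        Real.coe_toNNReal _ ha]
  exact (h.const_max 0).const_min 1

theorem deriv_ramp_sq_le {a : ℝ} (ha : 0 < a) (x : ℝ) :
    deriv (ramp a) x ^ 2 ≤ (Icc 0 (1 / a)).indicator (fun _ => a ^ 2) x := by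
  by_cases hx : x ∈ Icc 0 (1 / a)
  · rw [indicator_of_mem hx]
    have h := norm_deriv_le_of_lipschitz (x₀ := x) (lipschitzWith_ramp ha.le)
    rw [Real.coe_toNNReal _ ha.le, Real.norm_eq_abs] at h
    exact sq_le_sq' (by linarith [neg_abs_le (deriv (ramp a) x)]) ((le_abs_self _).trans h)
  · rw [indicator_of_notMem hx]
    suffices deriv (ramp a) x = 0 by rw [this]; simp
    rcases lt_or_ge x 0 with h | h
    · have : ramp a =ᶠ[𝓝 x] fun _ => 0 := by
        filter_upwards [Iio_mem_nhds h] with y hy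
        have : a * y ≤ 0 := mul_nonpos_of_nonneg_of_nonpos ha.le (le_of_lt hy)
        simp [ramp, this]
      rw [this.deriv_eq, deriv_const]
    · have h' : 1 / a < x := by
        by_contra hc
        exact hx ⟨h, not_lt.1 hc⟩
      have : ramp a =ᶠ[𝓝 x] fun _ => 1 := by
        filter_upwards [Ioi_mem_nhds h'] with y hy
        have : 1 ≤ a * y := by
          rw [mem_Ioi, div_lt_iff₀ ha] at hy
          linarith
        simp [ramp, this]
      rw [this.deriv_eq, deriv_const]

theorem isTestFunction_ramp {a : ℝ} (ha : 0 < a) (μ : Measure ℝ) [IsProbabilityMeasure μ] :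
    IsTestFunction μ (ramp a) := by
  refine ⟨ramp_nonneg a, fun b c =>
    (lipschitzWith_ramp ha.le).lipschitzOnWith.absolutelyContinuousOnInterval, ?_, ?_⟩
  · refine MemLp.of_bound (lipschitzWith_ramp ha.le).continuous.aestronglyMeasurable 1
      (Eventually.of_forall fun x => ?_)
    rw [Real.norm_of_nonneg (ramp_nonneg a x)]
    exact ramp_le_one a x
  · refine MemLp.of_bound (measurable_deriv _).aestronglyMeasurable a
      (Eventually.of_forall fun x => ?_)
    have h := norm_deriv_le_of_lipschitz (x₀ := x) (lipschitzWith_ramp ha.le)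
    rwa [Real.coe_toNNReal _ ha.le] at h

/-- Squared slope times length times density: `a² · (1 / a) · exp (-a² / 2)`. -/
theorem energy_ramp_le {a : ℝ} (ha : 0 < a) :
    energy (gaussianMixture a) (ramp a) ≤ (barrier a)⁻¹ := by
  have hi := integrable_gaussianMixture_iff.1
    (isTestFunction_ramp ha (gaussianMixture a)).memLp_deriv.integrable_sq
  rw [energy, integral_gaussianMixture]
  have h0 : (0 : ℝ) ≤ 1 / a := by positivity
  calc ∫ x, deriv (ramp a) x ^ 2 * mixtureDensity a x
      ≤ ∫ x, (Icc 0 (1 / a)).indicator (fun _ => a ^ 2 * Real.exp (-(a ^ 2 / 2))) x := by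
        refine integral_mono hi ((integrable_indicator_iff measurableSet_Icc).2
          (continuous_const.integrableOn_Icc)) fun x => ?_
        refine (mul_le_mul_of_nonneg_right (deriv_ramp_sq_le ha x)
          (mixtureDensity_pos a x).le).trans ?_
        by_cases hx : x ∈ Icc 0 (1 / a)
        · rw [indicator_of_mem hx, indicator_of_mem hx]
          have : a * x ≤ 1 := by
            have := mul_le_mul_of_nonneg_left hx.2 ha.le
            rwa [mul_one_div_cancel ha.ne'] at this
          exact mul_le_mul_of_nonneg_left (mixtureDensity_le_near_zero hx.1 this ha.le)
            (sq_nonneg a)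
        · rw [indicator_of_notMem hx, indicator_of_notMem hx, zero_mul]
    _ = (barrier a)⁻¹ := by
        rw [integral_indicator measurableSet_Icc, setIntegral_const, measureReal_def,
          Real.volume_Icc, ENNReal.toReal_ofReal (by simpa using h0), barrier, Real.exp_neg,
          smul_eq_mul]
        field_simp
        simp

/-- With `g` the ramp and `G = ∫ g²`, integrating `log (g² / (2 G)) ≥ 1 - 2 G / g²` against `g²`
over the half-line of mass `1 / 2` gives entropy at least `G log 2`. Since `1 / a ≤ a`, the ramp
equals `1` past `a`, so `G ≥ 1 / 4`. -/
theorem entropy_ramp_ge {a : ℝ} (ha : 1 ≤ a)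
    (hi : Integrable (fun x => ramp a x ^ 2 *
      Real.log (ramp a x ^ 2 / ∫ y, ramp a y ^ 2 ∂gaussianMixture a)) (gaussianMixture a)) :
    Real.log 2 / 4 ≤ entropy (gaussianMixture a) (fun x => ramp a x ^ 2) := by
  have ht := isTestFunction_ramp (a := a) (by linarith) (gaussianMixture a)
  have hsq := ht.memLp.integrable_sq
  unfold entropy
  set G := ∫ y, ramp a y ^ 2 ∂gaussianMixture a with hG
  have hsq' := integrable_gaussianMixture_iff.1 hsq
  have hG4 : 1 / 4 ≤ G := by
    refine (quarter_le_integral_Ioi_mixtureDensity a).trans ?_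
    rw [hG, integral_gaussianMixture, ← integral_indicator measurableSet_Ioi]
    refine integral_mono ((integrable_mixtureDensity a).indicator measurableSet_Ioi) hsq'
      fun x => ?_
    have hp := mixtureDensity_pos a x
    by_cases hx : x ∈ Ioi a
    · rw [indicator_of_mem hx]
      have : 1 ≤ a * x := by
        have := mem_Ioi.1 hx
        nlinarith
      simp [ramp, this]
    · rw [indicator_of_notMem hx]
      positivity
  have hG0 : 0 < G := by linarith
  have hone : Integrable ((Ioi (0 : ℝ)).indicator fun _ => 2 * G) (gaussianMixture a) :=
    (integrable_const _).indicator measurableSet_Ioi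
  have hint : ∫ x, (Ioi (0 : ℝ)).indicator (fun _ => 2 * G) x ∂gaussianMixture a = G := by
    rw [integral_gaussianMixture]
    simp only [← indicator_mul_left]
    rw [integral_indicator measurableSet_Ioi, integral_const_mul, integral_Ioi_zero_mixtureDensity]
    ring
  have hmono := integral_mono ((hsq.mul_const (Real.log 2 + 1)).sub hone) hi fun x => by
    show ramp a x ^ 2 * (Real.log 2 + 1) - (Ioi (0 : ℝ)).indicator (fun _ => 2 * G) x ≤
      ramp a x ^ 2 * Real.log (ramp a x ^ 2 / G)
    have hind : 0 ≤ (Ioi (0 : ℝ)).indicator (fun _ => 2 * G) x :=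
      indicator_nonneg (fun _ _ => by positivity) x
    rcases (ramp_nonneg a x).eq_or_lt with h0 | h0
    · rw [← h0]
      simpa using hind
    · have hx : x ∈ Ioi (0 : ℝ) := by
        by_contra hc
        have : a * x ≤ 0 := mul_nonpos_of_nonneg_of_nonpos (by linarith) (by simpa using hc)
        simp [ramp, this] at h0
      rw [indicator_of_mem hx]
      set g := ramp a x
      have h1 := Real.one_sub_inv_le_log_of_pos (show 0 < g ^ 2 / G / 2 by positivity)
      rw [Real.log_div (by positivity) two_ne_zero] at h1
      have h2 := mul_le_mul_of_nonneg_left h1 (sq_nonneg g)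
      have h3 : g ^ 2 * (1 - (g ^ 2 / G / 2)⁻¹) = g ^ 2 - 2 * G := by
        field_simp
      linarith
  have heq : ∫ x, (ramp a x ^ 2 * (Real.log 2 + 1) - (Ioi (0 : ℝ)).indicator (fun _ => 2 * G) x)
      ∂gaussianMixture a = G * Real.log 2 := by
    rw [integral_sub (hsq.mul_const _) hone, integral_mul_const, hint, ← hG]
    ring
  have hlog : 0 ≤ Real.log 2 := Real.log_nonneg (by norm_num)
  refine le_trans ?_ (heq.symm.le.trans hmono)
  nlinarith

theorem barrier_le_of_satisfiesLSI {a c : ℝ} (ha : 1 ≤ a)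
    (h : SatisfiesLSI (gaussianMixture a) c) : 1 / 11 * barrier a ≤ c := by
  have ha0 : 0 < a := by linarith
  obtain ⟨h1, h2⟩ := h _ (isTestFunction_ramp ha0 _)
  have h3 := entropy_ramp_ge ha h1
  have h4 := energy_ramp_le ha0
  have h5 : 0 ≤ energy (gaussianMixture a) (ramp a) := integral_nonneg fun x => sq_nonneg _
  have h6 := Real.log_two_gt_d9
  have hK := one_le_barrier ha
  have hc : 0 ≤ c := by
    by_contra hc
    have := mul_nonpos_of_nonpos_of_nonneg (not_le.1 hc).le h5
    linarith
  have h7 := mul_le_mul_of_nonneg_left h4 hc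
  -- `1 / 11` is a rational number below `log 2 / 4`.
  have h8 : 1 / 11 ≤ c * (barrier a)⁻¹ := by linarith
  rwa [← div_eq_mul_inv, le_div_iff₀ (by linarith)] at h8

/-! ### Scaling and the optimal constant -/

theorem SatisfiesLSI.map_mul_left {μ : Measure ℝ} {c s : ℝ} (hs : s ≠ 0) (h : SatisfiesLSI μ c) :
    SatisfiesLSI (μ.map (s * ·)) (s ^ 2 * c) := by
  have he : MeasurableEmbedding (fun x : ℝ => s * x) :=
    (Homeomorph.mulLeft₀ s hs).measurableEmbedding
  intro f hf
  have hd : ∀ x, deriv (fun x => f (s * x)) x = s * deriv f (s * x) := fun x => by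
    rw [deriv_comp_mul_left, smul_eq_mul]
  have ht : IsTestFunction μ (fun x => f (s * x)) := by
    refine ⟨fun x => hf.nonneg _,
      absolutelyContinuousOnInterval_comp_mul hf.absolutelyContinuous s,
      (he.memLp_map_measure_iff).1 hf.memLp, ?_⟩
    have := ((he.memLp_map_measure_iff).1 hf.memLp_deriv).const_mul s
    simpa only [funext hd, Function.comp_apply] using this
  obtain ⟨h1, h2⟩ := h _ ht
  unfold entropy energy at *
  simp only [he.integral_map, he.integrable_map_iff, Function.comp_def]
  refine ⟨h1, h2.trans_eq ?_⟩
  simp only [hd, mul_pow]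
  rw [integral_const_mul]
  ring

theorem gaussianSmoothing_twoPointMeasure {R δ : ℝ} (hδ : 0 < δ) :
    gaussianSmoothing (twoPointMeasure R) δ = (gaussianMixture (R / √δ)).map (√δ * ·) := by
  have hs : 0 < √δ := Real.sqrt_pos.2 hδ
  have hv : NNReal.mk (√δ ^ 2) (sq_nonneg _) * 1 = δ.toNNReal := by
    ext
    simp [Real.sq_sqrt hδ.le, hδ.le]
  rw [gaussianMixture_eq, gaussianSmoothing, twoPointMeasure, Measure.conv_smul_left,
    Measure.add_conv, Measure.dirac_conv, Measure.dirac_conv, Measure.map_smul,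
    Measure.map_add _ _ (by fun_prop), gaussianReal_map_const_mul, gaussianReal_map_const_mul,
    gaussianReal_map_const_add, gaussianReal_map_const_add, hv, mul_neg,
    mul_div_cancel₀ _ hs.ne', zero_add, zero_add]

/-- For each `f` the inequality is a closed condition on `c`, so it passes to the infimum. The bound
`L` keeps `sInf` from taking its default value on sets unbounded below. -/
theorem SatisfiesLSI.isLeast {μ : Measure ℝ} {C L : ℝ} (h : SatisfiesLSI μ C)
    (hL : ∀ c, SatisfiesLSI μ c → L ≤ c) :
    IsLeast {c : ℝ | SatisfiesLSI μ c} (logSobolevConstant μ) := by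
  have hb : BddBelow {c : ℝ | SatisfiesLSI μ c} := ⟨L, fun c hc => hL c hc⟩
  refine ⟨fun f hf => ⟨(h f hf).1, ?_⟩, fun c hc => csInf_le hb hc⟩
  have hE : 0 ≤ energy μ f := integral_nonneg fun x => sq_nonneg _
  rcases hE.eq_or_lt with h0 | h0
  · simpa [← h0] using (h f hf).2
  · rw [← div_le_iff₀ h0]
    exact le_csInf ⟨C, h⟩ fun c hc => (div_le_iff₀ h0).2 (hc f hf).2

theorem mainTheorem5 (R δ : ℝ) (hR : 0 < R) (hδ : 0 < δ) (hδR : δ ≤ R ^ 2) :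
    IsLeast {c : ℝ | SatisfiesLSI (gaussianSmoothing (twoPointMeasure R) δ) c}
        (logSobolevConstant (gaussianSmoothing (twoPointMeasure R) δ)) ∧
      (1 / 11 : ℝ) * (δ ^ (3 / 2 : ℝ) / R) * Real.exp (R ^ 2 / (2 * δ)) ≤
        logSobolevConstant (gaussianSmoothing (twoPointMeasure R) δ) ∧
      logSobolevConstant (gaussianSmoothing (twoPointMeasure R) δ) ≤
        117942 * (δ ^ (3 / 2 : ℝ) / R) * Real.exp (R ^ 2 / (2 * δ)) := by
  have hs : 0 < √δ := Real.sqrt_pos.2 hδ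
  have hs2 : √δ ^ 2 = δ := Real.sq_sqrt hδ.le
  set a := R / √δ with ha_def
  have ha : 1 ≤ a := by
    rw [ha_def, one_le_div hs]
    exact Real.sqrt_le_iff.2 ⟨hR.le, hδR⟩
  have hK := one_le_barrier ha
  have hrate : δ ^ (3 / 2 : ℝ) / R * Real.exp (R ^ 2 / (2 * δ)) = δ * barrier a := by
    have h1 : δ ^ (3 / 2 : ℝ) = δ * √δ := by
      rw [show (3 / 2 : ℝ) = 1 + 1 / 2 by norm_num, Real.rpow_add hδ, Real.rpow_one,
        ← Real.sqrt_eq_rpow]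
    have h2 : a ^ 2 / 2 = R ^ 2 / (2 * δ) := by
      rw [ha_def, div_pow, hs2]
      field_simp
    rw [barrier, h2, h1, ha_def]
    field_simp
  have hup : SatisfiesLSI (gaussianSmoothing (twoPointMeasure R) δ)
      (δ * (14496 * barrier a)) := by
    rw [gaussianSmoothing_twoPointMeasure hδ]
    have := (satisfiesLSI_gaussianMixture ha).map_mul_left hs.ne'
    rwa [hs2] at this
  have hlow : ∀ c, SatisfiesLSI (gaussianSmoothing (twoPointMeasure R) δ) c →
      1 / 11 * (δ * barrier a) ≤ c := by
    intro c hc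
    rw [gaussianSmoothing_twoPointMeasure hδ] at hc
    have h := hc.map_mul_left (inv_ne_zero hs.ne')
    rw [Measure.map_map (by fun_prop) (by fun_prop)] at h
    have hid : ((fun x => (√δ)⁻¹ * x) ∘ fun x => √δ * x) = id := by
      funext x
      simp [hs.ne']
    rw [hid, Measure.map_id, inv_pow, hs2] at h
    have h' := barrier_le_of_satisfiesLSI ha h
    rw [inv_mul_eq_div, le_div_iff₀ hδ] at h'
    linarith
  have hl := hup.isLeast hlow
  rw [mul_assoc, mul_assoc, hrate]
  -- The argument yields 14496, well below the stated 117942.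
  refine ⟨hl, hlow _ hl.1, (hl.2 hup).trans ?_⟩
  have : 0 ≤ δ * barrier a := by positivity
  linarith
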